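/- A preference sequence $(a_1,\dots,a_n)\in\{1,\dots,n\}^n$ describes $n$ cars parking one after the other in spaces $1,\dots,n$: car $i$ takes the first unoccupied space among $a_i,a_i+1,\dots,n$. It is a parking function of length $n$ if all cars can park. Let $p^l_{n;\le s}$ be the number of parking functions of length $n$ with $a_1=l$ and $a_i\le s$ for all $i$, and let $p^l_n=p^l_{n;\le n}$. Let $P(x)=\sum_{n\ge0}\frac{(n+1)^{n-1}}{n!}x^n$. Identities between generating functions are identities of formal power series with real coefficients. (a) For every $l\ge1$ the limit $\tau_l=\lim_{n\to\infty}\frac{p^l_n}{(n+1)^{n-2}}$ exists; $\tau_1=2$, and for every $l\ge1$ $$\tau_l-\tau_{l+1}=\frac{l^{l-2}}{(l-1)!}e^{-l}.$$ Moreover $$\sum_{l\ge1}\tau_lx^l=\frac{\frac{x^2}{e}P\left(\frac xe\right)-2x}{x-1}.$$ (b) For every $l\ge1$ and $k\ge0$ the limit $\rho_{l,k}=\lim_{n\to\infty}\frac{p^l_{n;\le n-k}}{(n+1)^{n-2}}$ exists, $\rho_{l,0}=\tau_l$, for every $k\ge1$ $$\rho_{l,k}=\rho_{l,k-1}-\sum_{i=1}^k\frac{e^{-i}}{i!}\rho_{l,k-i},$$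 and for every $k\ge0$ $$\rho_{l,k}=\rho_{l,0}\sum_{i=0}^k\frac{(-1)^i(k+1-i)^i}{i!}e^{-i}.$$ Moreover $\rho_l(x)=\sum_{k\ge0}\rho_{l,k}x^k$ satisfies $\rho_l(x)=\rho_{l,0}\,(e^{x/e}-x)^{-1}$ for every $l\ge1$. (c) The series $\rho(x,y)=\sum_{l\ge1}\rho_l(x)y^l$ satisfies $$\rho(x,y)=\frac{\frac{y^2}{e}P\left(\frac ye\right)-2y}{(y-1)\left(e^{x/e}-x\right)}.$$ All denominators are invertible as formal power series. -/

import Mathlib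

open Filter Topology

namespace LeadingParking

/-- All cars with preferences `a₁, a₂, …` (in this order) can be parked in the spaces `1, …, m`,
when the spaces in `occ` are already taken: each car takes the first free space among those
numbered at least its preference, and such a space must exist. -/
def AllPark (m : ℕ) : Finset ℕ → List ℕ → Prop
  | _, [] => True
  | occ, a :: as =>
      ∃ h : (Finset.Icc a m \ occ).Nonempty,
        AllPark m (insert ((Finset.Icc a m \ occ).min' h) occ) as

/-- The set of parking functions `(a₁, …, aₙ)` of length `n` (`n` cars, `n` spaces), all of whose
entries lie in `{1, …, s}`, and whose leading term `a₁` is `l`. -/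
def parkingFunctions (n s l : ℕ) : Set (Fin n → ℕ) :=
  {a | (∀ i, 1 ≤ a i ∧ a i ≤ s) ∧ AllPark n ∅ (List.ofFn a) ∧ ∃ h : 0 < n, a ⟨0, h⟩ = l}

/-- The number of parking functions of length `n` with entries at most `s` and leading term `l`. -/
noncomputable def numPark (n s l : ℕ) : ℕ := (parkingFunctions n s l).ncard

/-- The normalized number of parking functions of length `n` with leading term `l`. -/
noncomputable def tauSeq (l n : ℕ) : ℝ :=
  (numPark n n l : ℝ) / ((n : ℝ) + 1) ^ ((n : ℤ) - 2)

/-- The normalized number of parking functions of length `n` with entries at most `n - k` and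
leading term `l` (only `n > k` matters). -/
noncomputable def rhoSeq (l k n : ℕ) : ℝ :=
  (numPark n (n - k) l : ℝ) / ((n : ℝ) + 1) ^ ((n : ℤ) - 2)

noncomputable def tau (l : ℕ) : ℝ := limUnder atTop (tauSeq l)

noncomputable def rho (l k : ℕ) : ℝ := limUnder atTop (rhoSeq l k)

/-- `P(x) = ∑_{n ≥ 0} (n+1)^(n-1) / n! * x^n`. -/
noncomputable def P : PowerSeries ℝ :=
  PowerSeries.mk fun n => ((n : ℝ) + 1) ^ ((n : ℤ) - 1) / (n.factorial : ℝ)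

/-- `P(x/e)`. -/
noncomputable def PScaled : PowerSeries ℝ := PowerSeries.rescale (Real.exp (-1)) P

/-- `e^(x/e)`. -/
noncomputable def expScaled : PowerSeries ℝ :=
  PowerSeries.rescale (Real.exp (-1)) (PowerSeries.exp ℝ)

/-- `τ(x) = ∑_{l ≥ 1} τ_l x^l`. -/
noncomputable def tauGen : PowerSeries ℝ :=
  PowerSeries.mk fun l => if l = 0 then 0 else tau l

/-- `ρ_l(x) = ∑_{k ≥ 0} ρ_{l,k} x^k`. -/
noncomputable def rhoGen (l : ℕ) : PowerSeries ℝ := PowerSeries.mk fun k => rho l k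

/-- `ρ(x,y) = ∑_{l ≥ 1} ρ_l(x) y^l`, a power series in `y` over the power series in `x`. -/
noncomputable def rhoGen₂ : PowerSeries (PowerSeries ℝ) :=
  PowerSeries.mk fun l => if l = 0 then 0 else rhoGen l

/-- `(y²/e) P(y/e) - 2y`, as a power series in its variable `y`. -/
noncomputable def numerator : PowerSeries ℝ :=
  PowerSeries.C (Real.exp (-1)) * PowerSeries.X ^ 2 * PScaled - 2 * PowerSeries.X

/-- `(y - 1) (e^(x/e) - x)`, as a power series in `y` over the power series in `x`. -/
noncomputable def denominator₂ : PowerSeries (PowerSeries ℝ) :=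
  (PowerSeries.X - 1) * PowerSeries.C (expScaled - PowerSeries.X)

end LeadingParking

namespace LeadingParking

/-! A sequence parks iff, for every `j`, at least `j` entries are at most `j` (`allPark_iff`). With
the first car removed, the other cars satisfy the same inequalities, relaxed by one for `j ≥ l`.
`Pref` allows an arbitrary slack `w j`, so that cutting the street after space `t` gives a binomial
convolution inside the same family (`prefCount_add`).

Three cuts suffice. Cutting after space 1 gives the count of `m` cars in `n` spaces, hence `τ_1 =
2`. Cutting after space `l` shows that leads `l` and `l + 1` differ only when exactly `l - 1` other
cars prefer the first `l` spaces, so the counts differ by `(n-1).choose (l-1) * l^(l-2) *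
(n-l+1)^(n-l-1)`. Cutting off the last allowed space gives a recursion in `k`. After normalization,
`tendsto_choose_mul_zpow` supplies every limit. The recursions then say that `τ(x)(x - 1)` and
`ρ_l(x)(e^(x/e) - x)` are the stated series. -/

/-! ### The counting criterion for parking -/

/-- Cars can park behind an occupied set iff no final segment of spaces is overloaded. -/
theorem allPark_iff (m : ℕ) (L : List ℕ) : ∀ occ : Finset ℕ, (∀ a ∈ L, 1 ≤ a ∧ a ≤ m) →
    (AllPark m occ L ↔ (L = [] ∨ ∀ b, 1 ≤ b → b ≤ m →
      L.countP (fun x => decide (b ≤ x)) + (Finset.Icc b m ∩ occ).card ≤ m + 1 - b)) := by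
  induction L with
  | nil => intro occ _; simp [AllPark]
  | cons a as ih =>
    intro occ hL
    have ha := hL a (by simp)
    have has : ∀ x ∈ as, 1 ≤ x ∧ x ≤ m := fun x hx => hL x (by simp [hx])
    have hle : ∀ (o : Finset ℕ) b, (Finset.Icc b m ∩ o).card ≤ m + 1 - b := fun o b => by
      simpa using Finset.card_le_card (Finset.inter_subset_left (s₁ := Finset.Icc b m) (s₂ := o))
    -- The alternative `as = []` is absorbed: a segment of `m + 1 - b` spaces never holds more
    -- occupied ones.
    have ih' : ∀ o : Finset ℕ, AllPark m o as ↔ ∀ b, 1 ≤ b → b ≤ m →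
        as.countP (fun x => decide (b ≤ x)) + (Finset.Icc b m ∩ o).card ≤ m + 1 - b := by
      intro o
      rw [ih o has]
      constructor
      · rintro (rfl | h)
        · intro b _ _; simpa using hle o b
        · exact h
      · exact Or.inr
    -- Replacing the waiting car `a` by the occupied space `p` changes the inequalities only for `a
    -- < b ≤ p`. There the one at `b` follows from the one at `a`, since the spaces `a, …, b - 1`
    -- are all occupied.
    have key : ∀ p, p ∈ Finset.Icc a m \ occ → (∀ q, a ≤ q → q < p → q ∈ occ) →
        ((∀ b, 1 ≤ b → b ≤ m → as.countP (fun x => decide (b ≤ x)) +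
            (Finset.Icc b m ∩ insert p occ).card ≤ m + 1 - b) ↔
          ∀ b, 1 ≤ b → b ≤ m → (a :: as).countP (fun x => decide (b ≤ x)) +
            (Finset.Icc b m ∩ occ).card ≤ m + 1 - b) := by
      intro p hp hq
      simp only [Finset.mem_sdiff, Finset.mem_Icc] at hp
      have hins : ∀ b, (Finset.Icc b m ∩ insert p occ).card =
          (Finset.Icc b m ∩ occ).card + if b ≤ p then 1 else 0 := by
        intro b
        split_ifs with h
        · rw [Finset.inter_insert_of_mem (by simp; omega), Finset.card_insert_of_notMem]
          simp [hp.2]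
        · rw [Finset.inter_insert_of_notMem (by simp; omega), add_zero]
      have hmono : ∀ b, a ≤ b → as.countP (fun x => decide (b ≤ x)) ≤
          as.countP (fun x => decide (a ≤ x)) := fun b hb =>
        List.countP_mono_left (fun x _ hx => by simp at hx ⊢; omega)
      have hocc : ∀ b, a ≤ b → b ≤ p →
          (b - a) + (Finset.Icc b m ∩ occ).card ≤ (Finset.Icc a m ∩ occ).card := by
        intro b h1 h2
        have hd : Disjoint (Finset.Ico a b) (Finset.Icc b m ∩ occ) := by
          rw [Finset.disjoint_left]; intro x hx; simp at hx ⊢; omega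
        rw [← Nat.card_Ico, ← Finset.card_union_of_disjoint hd]
        refine Finset.card_le_card fun x hx => ?_
        simp only [Finset.mem_union, Finset.mem_Ico, Finset.mem_inter, Finset.mem_Icc] at hx ⊢
        rcases hx with hx | hx
        · exact ⟨by omega, hq x hx.1 (by omega)⟩
        · exact ⟨by omega, hx.2⟩
      simp only [List.countP_cons, hins, decide_eq_true_eq]
      constructor
      · intro h b hb1 hb2
        have := h b hb1 hb2
        split_ifs at this ⊢ <;> omega
      · intro h b hb1 hb2
        have h1 := h b hb1 hb2
        have h2 := h a ha.1 ha.2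
        simp only [le_refl, if_true] at h2
        by_cases hab : a < b ∧ b ≤ p
        · have := hmono b hab.1.le
          have := hocc b hab.1.le hab.2
          rw [if_pos hab.2]
          omega
        · split_ifs at h1 ⊢ <;> omega
    simp only [AllPark, reduceCtorEq, false_or]
    have hmin : ∀ h : (Finset.Icc a m \ occ).Nonempty, ∀ q, a ≤ q →
        q < (Finset.Icc a m \ occ).min' h → q ∈ occ := by
      intro h q h1 h2
      by_contra hq
      have h3 := Finset.min'_mem _ h
      simp only [Finset.mem_sdiff, Finset.mem_Icc] at h3
      have := Finset.min'_le (Finset.Icc a m \ occ) q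
        (Finset.mem_sdiff.2 ⟨Finset.mem_Icc.2 ⟨h1, by omega⟩, hq⟩)
      omega
    constructor
    · rintro ⟨h, hall⟩
      exact (key _ (Finset.min'_mem _ h) (hmin h)).1 ((ih' _).1 hall)
    · intro hall
      have h : (Finset.Icc a m \ occ).Nonempty := by
        rw [Finset.sdiff_nonempty]
        intro hsub
        have h2 := hall a ha.1 ha.2
        rw [Finset.inter_eq_left.2 hsub] at h2
        simp at h2
      exact ⟨h, (ih' _).2 ((key _ (Finset.min'_mem _ h) (hmin h)).2 hall)⟩

/-! ### Preference functions with slack, and cutting the street -/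

/-- The functions `f : ι → {1, …, s}` such that at least `j - w j` values are at most `j`, for
every `j ≤ s`. -/
def Pref (ι : Type*) (s : ℕ) (w : ℕ → ℤ) : Type _ :=
  {f : ι → ℕ // (∀ i, 1 ≤ f i ∧ f i ≤ s) ∧ ∀ j ≤ s, (j : ℤ) ≤ Nat.card {i // f i ≤ j} + w j}

instance {ι : Type*} [Finite ι] (s : ℕ) (w : ℕ → ℤ) : Finite (Pref ι s w) := by
  refine Finite.of_injective (β := ι → Fin (s + 1))
    (fun f i => ⟨f.1 i, Nat.lt_succ_of_le (f.2.1 i).2⟩) fun f g h => ?_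
  refine Subtype.ext (funext fun i => ?_)
  simpa using congrFun h i

/-- The number of functions from an `m`-element set in `Pref`. -/
noncomputable def prefCount (m s : ℕ) (w : ℕ → ℤ) : ℕ := Nat.card (Pref (Fin m) s w)

theorem card_pref {ι : Type*} [Finite ι] (s : ℕ) (w : ℕ → ℤ) :
    Nat.card (Pref ι s w) = prefCount (Nat.card ι) s w := by
  have e : ι ≃ Fin (Nat.card ι) := Finite.equivFin ι
  refine Nat.card_congr ((Equiv.arrowCongr e (Equiv.refl ℕ)).subtypeEquiv fun f => ?_)
  have h : ∀ j, Nat.card {i // f i ≤ j} = Nat.card {i // f (e.symm i) ≤ j} := fun j =>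
    Nat.card_congr (e.subtypeEquiv fun i => by simp)
  simp only [Equiv.arrowCongr_apply, Equiv.coe_refl, Function.comp_apply, id_eq, h]
  rw [e.symm.forall_congr_left]
  simp

theorem prefCount_congr {m s : ℕ} {v w : ℕ → ℤ}
    (h : ∀ f : Fin m → ℕ, (∀ i, 1 ≤ f i ∧ f i ≤ s) →
      ((∀ j ≤ s, (j : ℤ) ≤ Nat.card {i // f i ≤ j} + v j) ↔
        ∀ j ≤ s, (j : ℤ) ≤ Nat.card {i // f i ≤ j} + w j)) :
    prefCount m s v = prefCount m s w :=
  Nat.card_congr (Equiv.subtypeEquivRight fun f => and_congr_right (h f))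

theorem prefCount_eq_zero {m s : ℕ} {w : ℕ → ℤ} (j : ℕ) (hj : j ≤ s)
    (h : (m : ℤ) + w j < j) : prefCount m s w = 0 := by
  rw [prefCount, Nat.card_eq_zero]
  refine Or.inl ⟨fun f => ?_⟩
  have h1 := f.2.2 j hj
  have h2 : Nat.card {i // f.1 i ≤ j} ≤ m := by
    simpa using Finite.card_subtype_le (fun i => f.1 i ≤ j)
  omega

theorem card_le_of_le {ι : Type*} [Finite ι] {f : ι → ℕ} {j : ℕ} (h : ∀ i, f i ≤ j) :
    Nat.card {i // f i ≤ j} = Nat.card ι :=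
  Nat.card_congr (Equiv.subtypeUnivEquiv h)

/-- `S` is the set of cars preferring the first `t` spaces. Conditions at `j ≤ t` see only `S`; a
condition at `t + j` sees all of `S` plus the other cars shifted down by `t`, which accounts for the
new slack. -/
theorem card_fiber_pref {ι : Type*} [Fintype ι] [DecidableEq ι] (t r : ℕ) (w : ℕ → ℤ)
    (S : Finset ι) :
    Nat.card {f : Pref ι (t + r) w // Finset.univ.filter (fun i => f.1 i ≤ t) = S} =
      Nat.card (Pref {i // i ∈ S} t w) *
        Nat.card (Pref {i // i ∉ S} r (fun j => S.card + w (t + j) - t)) := by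
  have hlow : ∀ (f : ι → ℕ) j, (∀ i, f i ≤ j → i ∈ S) →
      Nat.card {i // f i ≤ j} = Nat.card {i : {i // i ∈ S} // f i ≤ j} := by
    intro f j h
    exact Nat.card_congr (Equiv.subtypeSubtypeEquivSubtype (h _)).symm
  have hhigh : ∀ (f : ι → ℕ) j, (∀ i, i ∈ S → f i ≤ j) →
      Nat.card {i // f i ≤ j} = S.card + Nat.card {i : {i // i ∉ S} // f i ≤ j} := by
    intro f j h
    classical
    rw [← Nat.card_congr (Equiv.sumCompl (fun i : {i // f i ≤ j} => i.1 ∈ S)), Nat.card_sum]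
    congr 1
    · rw [Nat.card_congr (Equiv.subtypeSubtypeEquivSubtypeInter (fun i => f i ≤ j) (· ∈ S)),
        Nat.card_congr (Equiv.subtypeEquivRight (q := (· ∈ S)) fun i => ⟨fun x => x.2, fun x => ⟨h i x, x⟩⟩)]
      simp
    · exact Nat.card_congr ((Equiv.subtypeSubtypeEquivSubtypeInter (fun i => f i ≤ j) (· ∉ S)).trans
        ((Equiv.subtypeEquivRight fun i => and_comm).trans
          (Equiv.subtypeSubtypeEquivSubtypeInter (· ∉ S) (fun i => f i ≤ j)).symm))
  rw [← Nat.card_prod]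
  refine Nat.card_congr
    { toFun := fun f => (⟨fun i => f.1.1 i, ?_⟩, ⟨fun i => f.1.1 i - t, ?_⟩)
      invFun := fun g => ⟨⟨fun i => if h : i ∈ S then g.1.1 ⟨i, h⟩ else t + g.2.1 ⟨i, h⟩, ?_⟩, ?_⟩
      left_inv := ?_
      right_inv := ?_ }
  · obtain ⟨⟨f, hf, hc⟩, hS⟩ := f
    subst hS
    refine ⟨fun i => ⟨(hf i).1, (Finset.mem_filter.1 i.2).2⟩, fun j hj => ?_⟩
    rw [← hlow f j (fun i hi => by simp; omega)]
    exact hc j (by omega)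
  · obtain ⟨⟨f, hf, hc⟩, hS⟩ := f
    have hS' : ∀ i, i ∈ S ↔ f i ≤ t := by rw [← hS]; simp
    refine ⟨fun i => ?_, fun j hj => ?_⟩
    · have h1 := hf i
      have h2 := (hS' i.1).not.1 i.2
      dsimp only
      omega
    · have h1 := hc (t + j) (by omega)
      rw [hhigh f (t + j) (fun i hi => by have := (hS' i).1 hi; omega)] at h1
      have h2 : Nat.card {i : {i // i ∉ S} // f i ≤ t + j} =
          Nat.card {i : {i // i ∉ S} // f i - t ≤ j} :=
        Nat.card_congr (Equiv.subtypeEquivRight fun i => by omega)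
      rw [h2] at h1
      push_cast at h1 ⊢
      omega
  · obtain ⟨⟨a, ha, hac⟩, ⟨b, hb, hbc⟩⟩ := g
    set f : ι → ℕ := fun i => if h : i ∈ S then a ⟨i, h⟩ else t + b ⟨i, h⟩ with hf
    have hfa : ∀ i (h : i ∈ S), f i = a ⟨i, h⟩ := fun i h => by simp [hf, h]
    have hfb : ∀ i (h : i ∉ S), f i = t + b ⟨i, h⟩ := fun i h => by simp [hf, h]
    refine ⟨fun i => ?_, fun j hj => ?_⟩
    · by_cases h : i ∈ S
      · have := ha ⟨i, h⟩; have := hfa i h; change 1 ≤ f i ∧ f i ≤ _; omega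
      · have := hb ⟨i, h⟩; have := hfb i h; change 1 ≤ f i ∧ f i ≤ _; omega
    · rcases le_or_gt j t with hjt | hjt
      · rw [hlow f j]
        · simp only [fun i : {i // i ∈ S} => hfa i.1 i.2]
          exact hac j hjt
        · intro i hi
          by_contra h
          have := hb ⟨i, h⟩; have := hfb i h; omega
      · rw [hhigh f j]
        · have h1 := hbc (j - t) (by omega)
          have h2 : Nat.card {i : {i // i ∉ S} // f i ≤ j} =
              Nat.card {i : {i // i ∉ S} // b i ≤ j - t} :=
            Nat.card_congr (Equiv.subtypeEquivRight fun i => by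
              have : f i = t + b i := hfb i.1 i.2
              omega)
          rw [h2]
          beta_reduce at h1
          rw [show t + (j - t) = j by omega] at h1
          push_cast [hjt.le] at h1 ⊢
          omega
        · intro i hi
          have := ha ⟨i, hi⟩; have := hfa i hi; omega
  · ext i
    obtain ⟨⟨a, ha, hac⟩, ⟨b, hb, hbc⟩⟩ := g
    by_cases h : i ∈ S
    · simpa [h] using (ha ⟨i, h⟩).2
    · have := hb ⟨i, h⟩
      simp [h]; omega
  · rintro ⟨⟨f, hf, hc⟩, hS⟩
    have hS' : ∀ i, i ∈ S ↔ f i ≤ t := by rw [← hS]; simp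
    refine Subtype.ext (Subtype.ext (funext fun i => ?_))
    by_cases h : i ∈ S
    · simp [h]
    · have := (hS' i).not.1 h
      simp [h]; omega
  · rintro ⟨⟨a, ha, hac⟩, ⟨b, hb, hbc⟩⟩
    refine Prod.ext (Subtype.ext (funext fun i => ?_)) (Subtype.ext (funext fun i => ?_))
    · simp
    · simp [i.2]

theorem prefCount_add (m t r : ℕ) (w : ℕ → ℤ) :
    prefCount m (t + r) w = ∑ k ∈ Finset.range (m + 1),
      m.choose k * (prefCount k t w * prefCount (m - k) r (fun j => k + w (t + j) - t)) := by
  have h := Finset.sum_powerset_apply_card (x := (Finset.univ : Finset (Fin m)))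
    (fun k => prefCount k t w * prefCount (m - k) r (fun j => k + w (t + j) - t))
  rw [Finset.card_univ, Fintype.card_fin] at h
  simp only [smul_eq_mul] at h
  rw [← h, prefCount, ← Nat.card_congr (Equiv.sigmaFiberEquiv
    fun f : Pref (Fin m) (t + r) w => Finset.univ.filter (fun i => f.1 i ≤ t)), Nat.card_sigma,
    Finset.powerset_univ]
  refine Finset.sum_congr rfl fun S _ => ?_
  rw [card_fiber_pref, card_pref, card_pref]
  have h1 : Nat.card {i // i ∈ S} = S.card := by simp
  have h2 : Nat.card {i // i ∉ S} = m - S.card := by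
    rw [Nat.card_eq_fintype_card, Fintype.card_subtype_compl]; simp
  rw [h1, h2]

theorem prefCount_eq_zero_of_neg {m s : ℕ} {w : ℕ → ℤ} (h : w 0 < 0) : prefCount m s w = 0 := by
  rw [prefCount, Nat.card_eq_zero]
  refine Or.inl ⟨fun f => ?_⟩
  have h1 := f.2.2 0 (Nat.zero_le s)
  have h2 : Nat.card {i // f.1 i ≤ 0} = 0 := by
    rw [Nat.card_eq_zero]
    exact Or.inl ⟨fun i => by have := (f.2.1 i.1).1; have := i.2; omega⟩
  rw [h2] at h1
  push_cast at h1
  omega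

theorem prefCount_one {m : ℕ} {w : ℕ → ℤ} (h0 : 0 ≤ w 0) (h1 : 1 ≤ m + w 1) :
    prefCount m 1 w = 1 := by
  rw [prefCount, Nat.card_eq_one_iff_unique]
  refine ⟨⟨fun f g => Subtype.ext (funext fun i => ?_)⟩, ⟨⟨fun _ => 1, by simp, fun j hj => ?_⟩⟩⟩
  · have := f.2.1 i; have := g.2.1 i; omega
  · rcases Nat.le_one_iff_eq_zero_or_eq_one.1 hj with rfl | rfl
    · simpa using h0
    · rw [card_le_of_le fun _ => le_rfl]
      simpa using h1

theorem prefCount_zero (n : ℕ) (w : ℕ → ℤ) (h : ∀ j ≤ n, (j : ℤ) ≤ w j) : prefCount 0 n w = 1 := by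
  rw [prefCount, Nat.card_eq_one_iff_unique]
  exact ⟨⟨fun f g => Subtype.ext (funext fun i => i.elim0)⟩,
    ⟨⟨fun i => i.elim0, fun i => i.elim0, fun j hj => by simpa using h j hj⟩⟩⟩

/-! ### Parking `m` cars in `n` spaces -/

/-- The binomial theorem combined with its derivative; the factor `1 + x` avoids the exponent `m -
1`. -/
theorem sum_choose_mul_sub_mul_pow (m : ℕ) (x : ℤ) :
    (1 + x) * ∑ j ∈ Finset.range (m + 1), (m.choose j : ℤ) * ((x - j) * x ^ j) =
      x * ((1 + x - m) * (1 + x) ^ m) := by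
  have h1 : ∑ j ∈ Finset.range (m + 1), (m.choose j : ℤ) * x ^ j = (1 + x) ^ m := by
    rw [add_comm 1 x, add_pow]
    exact Finset.sum_congr rfl fun j _ => by simp [mul_comm]
  have h2 : (1 + x) * ∑ j ∈ Finset.range (m + 1), (m.choose j : ℤ) * (j * x ^ j) =
      m * x * (1 + x) ^ m := by
    cases m with
    | zero => simp
    | succ p =>
      have h3 : ∑ j ∈ Finset.range (p + 1), (p.choose j : ℤ) * x ^ j = (1 + x) ^ p := by
        rw [add_comm 1 x, add_pow]
        exact Finset.sum_congr rfl fun j _ => by simp [mul_comm]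
      rw [Finset.sum_range_succ', pow_succ, ← h3]
      simp only [Nat.cast_zero, zero_mul, mul_zero, add_zero, Finset.mul_sum, Finset.sum_mul]
      refine Finset.sum_congr rfl fun j _ => ?_
      have := Nat.add_one_mul_choose_eq p j
      have h4 : ((p : ℤ) + 1) * p.choose j = (p + 1).choose (j + 1) * (j + 1) := by
        exact_mod_cast this
      push_cast
      linear_combination (-(1 + x) * x ^ (j + 1)) * h4
  have h3 : ∑ j ∈ Finset.range (m + 1), (m.choose j : ℤ) * ((x - j) * x ^ j) =
      x * ∑ j ∈ Finset.range (m + 1), (m.choose j : ℤ) * x ^ j -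
        ∑ j ∈ Finset.range (m + 1), (m.choose j : ℤ) * (j * x ^ j) := by
    rw [Finset.mul_sum, ← Finset.sum_sub_distrib]
    exact Finset.sum_congr rfl fun j _ => by ring
  rw [h3, mul_sub, h2, h1]
  ring

/-- The number of ways to park `m` cars in `n` spaces is `(n + 1 - m) (n + 1) ^ (m - 1)`. -/
theorem prefCount_const (n : ℕ) : ∀ m ≤ n + 1,
    ((n : ℤ) + 1) * prefCount m n (fun _ => n - m) = (n + 1 - m) * (n + 1) ^ m := by
  -- The degenerate case of one car too many is needed because the step to `n + 1` spaces uses up to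
  -- `n + 1` cars in `n` spaces.
  have top : ∀ n : ℕ, ((n : ℤ) + 1) * prefCount (n + 1) n (fun _ => n - (n + 1 : ℕ)) =
      (n + 1 - (n + 1 : ℕ)) * (n + 1) ^ (n + 1) := by
    intro n
    rw [prefCount_eq_zero_of_neg (by push_cast; omega)]
    simp
  induction n with
  | zero =>
    intro m hm
    rcases Nat.le_one_iff_eq_zero_or_eq_one.1 hm with rfl | rfl
    · rw [prefCount_zero 0 _ (by simp)]; simp
    · exact top 0
  | succ n ih =>
    intro m hm
    rcases hm.eq_or_lt with rfl | hm
    · exact top (n + 1)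
    -- Cut after space 1: `k` counts the cars that do not prefer space 1.
    have hrec : prefCount m (n + 1) (fun _ => (n + 1 : ℕ) - m) =
        ∑ k ∈ Finset.range (m + 1), m.choose k * prefCount k n (fun _ => n - k) := by
      rw [add_comm n 1, prefCount_add, ← Finset.sum_range_reflect]
      refine Finset.sum_congr rfl fun k hk => ?_
      have hk' : k ≤ m := Nat.lt_succ_iff.1 (Finset.mem_range.1 hk)
      have e1 : m + 1 - 1 - k = m - k := by omega
      have e2 : m - (m - k) = k := by omega
      rw [e1, e2, Nat.choose_symm hk']
      congr 1
      have e3 : (fun _ : ℕ => ((m - k : ℕ) : ℤ) + (((1 + n : ℕ) : ℤ) - m) - (1 : ℕ)) =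
          fun _ => (n : ℤ) - k := by
        funext _; push_cast [hk']; ring
      rw [e3]
      rcases Nat.lt_or_ge n k with h | h
      · rw [prefCount_eq_zero_of_neg (m := k) (s := n) (by omega), mul_zero]
      · rw [prefCount_one (by push_cast; omega) (by push_cast [hk']; omega), one_mul]
    have hs := sum_choose_mul_sub_mul_pow m ((n : ℤ) + 1)
    have hx : ((n : ℤ) + 1) ≠ 0 := by positivity
    apply mul_left_cancel₀ hx
    rw [hrec]
    push_cast
    rw [show (n : ℤ) + 1 + 1 = 1 + (n + 1) by ring, ← hs, ← mul_assoc, mul_comm ((n : ℤ) + 1),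
      mul_assoc, Finset.mul_sum]
    congr 1
    refine Finset.sum_congr rfl fun k hk => ?_
    have hk' : k ≤ m := Nat.lt_succ_iff.1 (Finset.mem_range.1 hk)
    rw [← ih k (by omega)]
    ring

/-! ### Effect of the leading car and of the bound -/

/-- The contribution of a first car with preference `l` to the number of preferences at most
`j`. -/
def leadWeight (l j : ℕ) : ℤ := if l ≤ j then 1 else 0

/-- A lead of 1 is a constant slack of 1, since the condition at `j = 0` is void. -/
theorem prefCount_leadWeight_one (m : ℕ) :
    ((m : ℤ) + 2) * prefCount m (m + 1) (leadWeight 1) = 2 * (m + 2) ^ m := by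
  have h := prefCount_const (m + 1) m (by omega)
  have e : prefCount m (m + 1) (leadWeight 1) = prefCount m (m + 1) (fun _ => (m + 1 : ℕ) - m) := by
    refine prefCount_congr fun f _ => forall₂_congr fun j _ => ?_
    rcases Nat.eq_zero_or_pos j with rfl | hj
    · simp [leadWeight]; omega
    · simp [leadWeight, Nat.succ_le_of_lt hj]
  rw [e]
  push_cast at h ⊢
  rw [show (m : ℤ) + 1 + 1 - m = 2 by ring, show (m : ℤ) + 1 + 1 = m + 2 by ring] at h
  exact h

/-- The condition at `j = p` already forces all `p` cars into the first `p` spaces; the lead car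
settles `j = p + 1`. -/
theorem prefCount_succ_self (p : ℕ) :
    prefCount p (p + 1) (leadWeight (p + 1)) = prefCount p p (fun _ => 0) := by
  refine Nat.card_congr (Equiv.subtypeEquivRight fun f => ?_)
  constructor
  · rintro ⟨h1, h2⟩
    have h3 : ∀ j ≤ p, (j : ℤ) ≤ Nat.card {i // f i ≤ j} + 0 := fun j hj => by
      have := h2 j (by omega)
      rwa [leadWeight, if_neg (by omega)] at this
    refine ⟨fun i => ⟨(h1 i).1, ?_⟩, h3⟩
    by_contra hi
    have h4 := h3 p le_rfl
    have h5 : Nat.card {i // f i ≤ p} < Nat.card (Fin p) := Finite.card_subtype_lt hi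
    rw [Nat.card_fin] at h5
    omega
  · rintro ⟨h1, h2⟩
    refine ⟨fun i => ⟨(h1 i).1, (h1 i).2.trans (by omega)⟩, fun j hj => ?_⟩
    rcases hj.eq_or_lt with rfl | hj
    · rw [card_le_of_le fun i => (h1 i).2.trans (by omega)]
      simp [leadWeight]
    · rw [leadWeight, if_neg (by omega)]
      exact h2 j (by omega)

/-- The two slacks differ only at `j = p + 1`. Let `k` cars prefer the first `p + 1` spaces: for `k
< p` both terms vanish, for `k > p` they agree, and for `k = p` only lead `p + 1` survives, leaving
parking functions of lengths `p` and `q`. -/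
theorem prefCount_leadWeight_succ (p q : ℕ) :
    prefCount (p + q) (p + q + 1) (leadWeight (p + 1)) =
      prefCount (p + q) (p + q + 1) (leadWeight (p + 2)) +
        (p + q).choose p * (prefCount p p (fun _ => 0) * prefCount q q (fun _ => 0)) := by
  rw [show p + q + 1 = (p + 1) + q by ring, prefCount_add, prefCount_add]
  have hterm : ∀ k ∈ Finset.range (p + q + 1), (p + q).choose k *
      (prefCount k (p + 1) (leadWeight (p + 1)) * prefCount (p + q - k) q
        (fun j => k + leadWeight (p + 1) (p + 1 + j) - (p + 1 : ℕ))) =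
      (p + q).choose k * (prefCount k (p + 1) (leadWeight (p + 2)) * prefCount (p + q - k) q
        (fun j => k + leadWeight (p + 2) (p + 1 + j) - (p + 1 : ℕ))) +
      if k = p then (p + q).choose p * (prefCount p p (fun _ => 0) * prefCount q q (fun _ => 0))
        else 0 := by
    intro k _
    rcases lt_trichotomy k p with h | rfl | h
    · rw [prefCount_eq_zero (w := leadWeight (p + 1)) (p + 1) le_rfl (by simp [leadWeight, h]),
        prefCount_eq_zero (w := leadWeight (p + 2)) (p + 1) le_rfl (by simp [leadWeight]; omega),
        if_neg h.ne]
      simp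
    · rw [prefCount_eq_zero (w := leadWeight (k + 2)) (k + 1) le_rfl (by simp [leadWeight]),
        if_pos rfl, prefCount_succ_self]
      simp [leadWeight]
    · have e1 : prefCount k (p + 1) (leadWeight (p + 1)) =
          prefCount k (p + 1) (leadWeight (p + 2)) := by
        refine prefCount_congr fun f hf => forall₂_congr fun j hj => ?_
        rcases hj.eq_or_lt with rfl | hj
        · rw [card_le_of_le fun i => (hf i).2, Nat.card_fin]
          simp [leadWeight]
          omega
        · rw [leadWeight, leadWeight, if_neg (by omega), if_neg (by omega)]
      have e2 : prefCount (p + q - k) q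
            (fun j => k + leadWeight (p + 1) (p + 1 + j) - (p + 1 : ℕ)) =
          prefCount (p + q - k) q
            (fun j => k + leadWeight (p + 2) (p + 1 + j) - (p + 1 : ℕ)) := by
        refine prefCount_congr fun f hf => forall₂_congr fun j hj => ?_
        rcases Nat.eq_zero_or_pos j with rfl | hj
        · simp [leadWeight]
          omega
        · simp only [leadWeight]
          rw [if_pos (by omega), if_pos (by omega)]
      rw [e1, e2, if_neg h.ne', add_zero]
  rw [Finset.sum_congr rfl hterm, Finset.sum_add_distrib, Finset.sum_ite_eq', if_pos (by simp)]

/-- `i` counts the cars preferring exactly `s + 1`. With `i > k`, too few cars remain for the first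
`s` spaces. -/
theorem prefCount_bound_succ (m s l k : ℕ) (hl : 1 ≤ l) (hls : l ≤ s) (hk : 1 ≤ k)
    (hsk : s + k = m + 1) :
    prefCount m (s + 1) (leadWeight l) = ∑ i ∈ Finset.range (k + 1),
      m.choose i * prefCount (m - i) s (leadWeight l) := by
  rw [prefCount_add, ← Finset.sum_range_reflect]
  symm
  refine Finset.sum_subset_zero_on_sdiff (Finset.range_mono (by omega)) (fun i hi => ?_)
    fun i hi => ?_
  · simp only [Finset.mem_sdiff, Finset.mem_range] at hi
    rw [prefCount_eq_zero (w := leadWeight l) s le_rfl (by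
      simp only [leadWeight, if_pos hls]; omega)]
    simp
  · have hi' : i ≤ k := Nat.lt_succ_iff.1 (Finset.mem_range.1 hi)
    have e1 : m + 1 - 1 - i = m - i := by omega
    have e2 : m - (m - i) = i := by omega
    rw [e1, e2, Nat.choose_symm (by omega), prefCount_one (m := i), mul_one]
    · simp only [leadWeight, if_pos (show l ≤ s + 0 by omega)]; omega
    · simp only [leadWeight, if_pos (show l ≤ s + 1 by omega)]; omega

/-! ### From parking functions to preference counts -/

theorem allPark_ofFn_iff {n : ℕ} (a : Fin n → ℕ) (ha : ∀ i, 1 ≤ a i ∧ a i ≤ n) :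
    AllPark n ∅ (List.ofFn a) ↔ ∀ j ≤ n, j ≤ Nat.card {i // a i ≤ j} := by
  have hc : ∀ j, (List.ofFn a).countP (fun x => decide (j + 1 ≤ x)) +
      Nat.card {i // a i ≤ j} = n := by
    intro j
    have h : (List.ofFn a).countP (fun x => decide (j + 1 ≤ x)) =
        Nat.card {i // ¬ a i ≤ j} := by
      have h1 : ((List.ofFn a : List ℕ) : Multiset ℕ) = Finset.univ.val.map a := by simp
      rw [← Multiset.coe_countP, h1, Multiset.countP_map, Nat.card_eq_fintype_card,
        Fintype.card_subtype]
      simp only [Nat.add_one_le_iff, not_le]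
      rfl
    rw [h, add_comm, ← Nat.card_sum, Nat.card_congr (Equiv.sumCompl _), Nat.card_eq_fintype_card,
      Fintype.card_fin]
  rw [allPark_iff n _ ∅ (by simpa [List.mem_ofFn] using ha)]
  constructor
  · rintro (h | h) j hj
    · have : n = 0 := by simpa using h
      omega
    · rcases Nat.lt_or_ge j n with h' | h'
      · have h1 := h (j + 1) (by omega) (by omega)
        have := hc j
        simp only [Finset.inter_empty, Finset.card_empty] at h1
        omega
      · rw [card_le_of_le fun i => (ha i).2.trans h']
        simpa using hj
  · refine fun h => Or.inr fun b h1 h2 => ?_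
    obtain ⟨j, rfl⟩ := Nat.exists_eq_add_of_le' h1
    have := hc j
    have := h j (by omega)
    simp only [Finset.inter_empty, Finset.card_empty]
    omega

/-- Deleting the first car is the bijection; the conditions for `j ≥ s` beyond the bound are
automatic, as all entries are at most `s`. -/
theorem numPark_eq_prefCount (m s l : ℕ) (hl : 1 ≤ l) (hls : l ≤ s) (hs : s ≤ m + 1) :
    numPark (m + 1) s l = prefCount m s (leadWeight l) := by
  have hcons : ∀ (b : Fin m → ℕ) j, ((Nat.card {i // (Fin.cons l b : Fin (m + 1) → ℕ) i ≤ j} : ℕ) : ℤ) =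
      Nat.card {i // b i ≤ j} + leadWeight l j := by
    intro b j
    rw [Nat.card_eq_fintype_card, Nat.card_eq_fintype_card, Fintype.card_subtype,
      Fintype.card_subtype, Fin.card_filter_univ_succ]
    simp only [Fin.cons_zero, Fin.cons_succ, leadWeight]
    split_ifs <;> simp
  have key : ∀ b : Fin m → ℕ, (∀ i, 1 ≤ b i ∧ b i ≤ s) →
      (AllPark (m + 1) ∅ (List.ofFn (Fin.cons l b : Fin (m + 1) → ℕ)) ↔
        ∀ j ≤ s, (j : ℤ) ≤ Nat.card {i // b i ≤ j} + leadWeight l j) := by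
    intro b hb
    have hle : ∀ i, 1 ≤ (Fin.cons l b : Fin (m + 1) → ℕ) i ∧
        (Fin.cons l b : Fin (m + 1) → ℕ) i ≤ s :=
      Fin.cases ⟨hl, hls⟩ (by simpa using hb)
    rw [allPark_ofFn_iff _ fun i => ⟨(hle i).1, (hle i).2.trans hs⟩]
    simp only [← hcons, Nat.cast_le]
    refine ⟨fun h j hj => h j (hj.trans hs), fun h j hj => ?_⟩
    rcases le_total j s with hjs | hjs
    · exact h j hjs
    · rw [card_le_of_le fun i => (hle i).2.trans hjs]
      simpa using hj
  rw [numPark, ← Nat.card_coe_set_eq]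
  refine Nat.card_congr
    { toFun := fun a => ⟨Fin.tail a.1, fun i => a.2.1 i.succ, ?_⟩
      invFun := fun b => ⟨Fin.cons l b.1, Fin.cases ⟨hl, hls⟩ (by simpa using b.2.1),
        (key b.1 b.2.1).2 b.2.2, Nat.succ_pos m, rfl⟩
      left_inv := ?_
      right_inv := fun b => Subtype.ext (by simp) }
  · obtain ⟨a, h1, h2, h3, h4⟩ := a
    refine (key _ fun i => h1 i.succ).1 ?_
    rw [← h4]
    simpa using h2
  · rintro ⟨a, h1, h2, h3, h4⟩
    refine Subtype.ext ?_
    change Fin.cons l (Fin.tail a) = a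
    rw [← h4]
    exact Fin.cons_self_tail a

/-! ### Asymptotics -/

theorem tendsto_choose_div_pow (i : ℕ) :
    Tendsto (fun m : ℕ => (m.choose i : ℝ) / ((m : ℝ) + 2) ^ i) atTop (𝓝 (1 / i.factorial)) := by
  have h1 : Tendsto (fun m : ℕ => (m.choose i : ℝ) / (m ^ i / i.factorial)) atTop (𝓝 1) := by
    refine (Asymptotics.isEquivalent_iff_tendsto_one ?_).1 (isEquivalent_choose i)
    filter_upwards [eventually_gt_atTop 0] with m hm
    positivity
  have h2 := (tendsto_natCast_div_add_atTop (2 : ℝ)).pow i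
  have h3 := (h1.mul h2).div_const (i.factorial : ℝ)
  rw [one_pow, mul_one] at h3
  refine h3.congr' ?_
  filter_upwards [eventually_gt_atTop 0] with m hm
  have : (m : ℝ) ≠ 0 := by positivity
  have : (m : ℝ) + 2 ≠ 0 := by positivity
  have : (i.factorial : ℝ) ≠ 0 := by positivity
  rw [div_pow]
  field_simp

/-- With `N = n + 1` the expression is `(n-1).choose i / N^i` times `(1 - a/N)^(N - i - 3)`. It is
used for `(a, i) = (l, l - 1)` in the `τ` recursion and `(i, i)` in the `ρ` recursion. -/
theorem tendsto_choose_mul_zpow (a i : ℕ) :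
    Tendsto (fun n : ℕ => ((n - 1).choose i : ℝ) *
      (((n : ℝ) + 1 - a) ^ ((n : ℤ) - i - 2) / ((n : ℝ) + 1) ^ ((n : ℤ) - 2))) atTop
      (𝓝 (Real.exp (-(a : ℝ)) / i.factorial)) := by
  rw [← tendsto_add_atTop_iff_nat 1]
  have h1 := (tendsto_add_atTop_iff_nat 2).2 (Real.tendsto_one_add_div_pow_exp (-(a : ℝ)))
  have h2 : Tendsto (fun m : ℕ => 1 + -(a : ℝ) / ((m + 2 : ℕ) : ℝ)) atTop (𝓝 1) := by
    have := (tendsto_add_atTop_iff_nat 2).2 (tendsto_const_div_atTop_nhds_zero_nat (-(a : ℝ)))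
    simpa using this.const_add 1
  have h3 := h2.zpow₀ (-(i : ℤ) - 3) (Or.inl one_ne_zero)
  have h4 := (tendsto_choose_div_pow i).mul (h1.mul h3)
  rw [one_zpow, mul_one, one_div_mul_eq_div] at h4
  refine h4.congr' ?_
  filter_upwards [eventually_gt_atTop a] with m hm
  have hN : (m : ℝ) + 2 ≠ 0 := by positivity
  have hm' : (a : ℝ) < m := by exact_mod_cast hm
  have hNa : (m : ℝ) + 2 - a ≠ 0 := by linarith
  have e1 : 1 + -(a : ℝ) / ((m + 2 : ℕ) : ℝ) = (m + 2 - a) / (m + 2) := by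
    push_cast; field_simp; ring
  have e2 : ((m + 1 : ℕ) : ℝ) + 1 = m + 2 := by push_cast; ring
  have e3 : ((m + 1 : ℕ) : ℤ) - 2 = (((m + 1 : ℕ) : ℤ) - i - 2) + i := by ring
  rw [e1, e2, Nat.add_sub_cancel, e3, zpow_add₀ hN, zpow_natCast, ← zpow_natCast _ (m + 2),
    ← zpow_add₀ (div_ne_zero hNa hN),
    show ((m + 2 : ℕ) : ℤ) + (-(i : ℤ) - 3) = ((m + 1 : ℕ) : ℤ) - i - 2 by push_cast; ring,
    div_zpow]
  field_simp

theorem prefCount_self (n : ℕ) :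
    (prefCount n n (fun _ => 0) : ℝ) = ((n : ℝ) + 1) ^ ((n : ℤ) - 1) := by
  have h := prefCount_const n n (by omega)
  simp only [sub_self, add_sub_cancel_left, one_mul] at h
  have h' : ((n : ℝ) + 1) * prefCount n n (fun _ => 0) = (n + 1) ^ n := by exact_mod_cast h
  have hn : (n : ℝ) + 1 ≠ 0 := by positivity
  rw [zpow_sub_one₀ hn, zpow_natCast, ← h']
  field_simp

/-! ### The limits `τ_l` -/

theorem tauSeq_one (n : ℕ) (hn : 1 ≤ n) : tauSeq 1 n = 2 := by
  obtain ⟨m, rfl⟩ := Nat.exists_eq_add_of_le' hn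
  have h := prefCount_leadWeight_one m
  rw [← numPark_eq_prefCount m (m + 1) 1 le_rfl (by omega) le_rfl] at h
  have h' : ((m : ℝ) + 2) * numPark (m + 1) (m + 1) 1 = 2 * (m + 2) ^ m := by exact_mod_cast h
  have hm : (m : ℝ) + 2 ≠ 0 := by positivity
  rw [tauSeq, show ((m + 1 : ℕ) : ℝ) + 1 = m + 2 by push_cast; ring,
    show ((m + 1 : ℕ) : ℤ) - 2 = (m : ℤ) - 1 by push_cast; ring, zpow_sub_one₀ hm, zpow_natCast]
  field_simp
  linarith

theorem tauSeq_sub (l n : ℕ) (hl : 1 ≤ l) (hn : l + 1 ≤ n) :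
    tauSeq l n - tauSeq (l + 1) n = (l : ℝ) ^ ((l : ℤ) - 2) *
      (((n - 1).choose (l - 1) : ℝ) * (((n : ℝ) + 1 - l) ^ ((n : ℤ) - (l - 1 : ℕ) - 2) /
        ((n : ℝ) + 1) ^ ((n : ℤ) - 2))) := by
  obtain ⟨p, rfl⟩ := Nat.exists_eq_add_of_le' hl
  obtain ⟨q, rfl⟩ : ∃ q, n = p + q + 1 := ⟨n - p - 1, by omega⟩
  have h := prefCount_leadWeight_succ p q
  rw [← numPark_eq_prefCount _ _ _ (by omega) (by omega) le_rfl,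
    ← numPark_eq_prefCount _ _ _ (by omega) (by omega) le_rfl] at h
  rw [tauSeq, tauSeq, h]
  push_cast
  rw [prefCount_self, prefCount_self,
    show (p : ℝ) + q + 1 + 1 - (p + 1) = q + 1 by ring,
    show (p : ℤ) + q + 1 - p - 2 = q - 1 by ring, show (p : ℤ) + 1 - 2 = p - 1 by ring]
  ring

theorem exists_tendsto_tauSeq (l : ℕ) (hl : 1 ≤ l) : ∃ x, Tendsto (tauSeq l) atTop (𝓝 x) := by
  induction l, hl using Nat.le_induction with
  | base =>
    refine ⟨2, tendsto_const_nhds.congr' ?_⟩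
    filter_upwards [eventually_ge_atTop 1] with n hn
    exact (tauSeq_one n hn).symm
  | succ l hl ih =>
    obtain ⟨x, hx⟩ := ih
    refine ⟨_, (hx.sub ((tendsto_choose_mul_zpow l (l - 1)).const_mul
      ((l : ℝ) ^ ((l : ℤ) - 2)))).congr' ?_⟩
    filter_upwards [eventually_ge_atTop (l + 1)] with n hn
    rw [← tauSeq_sub l n hl hn]
    ring

theorem tendsto_tauSeq (l : ℕ) (hl : 1 ≤ l) : Tendsto (tauSeq l) atTop (𝓝 (tau l)) :=
  tendsto_nhds_limUnder (exists_tendsto_tauSeq l hl)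

theorem tau_one : tau 1 = 2 := by
  refine tendsto_nhds_unique (tendsto_tauSeq 1 le_rfl) (tendsto_const_nhds.congr' ?_)
  filter_upwards [eventually_ge_atTop 1] with n hn
  exact (tauSeq_one n hn).symm

theorem tau_sub_tau_succ (l : ℕ) (hl : 1 ≤ l) :
    tau l - tau (l + 1) =
      (l : ℝ) ^ ((l : ℤ) - 2) / ((l - 1).factorial : ℝ) * Real.exp (-(l : ℝ)) := by
  rw [div_mul_eq_mul_div, mul_div_assoc]
  refine tendsto_nhds_unique ((tendsto_tauSeq l hl).sub (tendsto_tauSeq (l + 1) (by omega)))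
    (((tendsto_choose_mul_zpow l (l - 1)).const_mul ((l : ℝ) ^ ((l : ℤ) - 2))).congr' ?_)
  filter_upwards [eventually_ge_atTop (l + 1)] with n hn
  exact (tauSeq_sub l n hl hn).symm

/-! ### The limits `ρ_{l,k}` -/

/-- Dropping `i` cars keeps the bound `n - k = (n - i) - (k - i)`, so each term is again a `rhoSeq`.
The `i = 0` term is the left side. -/
theorem rhoSeq_rec (l k n : ℕ) (hl : 1 ≤ l) (hk : 1 ≤ k) (hn : k + l ≤ n) :
    rhoSeq l k n = rhoSeq l (k - 1) n - ∑ i ∈ Finset.Icc 1 k, ((n - 1).choose i : ℝ) *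
      (((n : ℝ) + 1 - i) ^ ((n : ℤ) - i - 2) / ((n : ℝ) + 1) ^ ((n : ℤ) - 2)) *
        rhoSeq l (k - i) (n - i) := by
  obtain ⟨m, rfl⟩ : ∃ m, n = m + 1 := ⟨n - 1, by omega⟩
  have h := prefCount_bound_succ m (m + 1 - k) l k hl (by omega) hk (by omega)
  rw [← numPark_eq_prefCount _ _ _ hl (by omega) (by omega), Finset.sum_range_succ',
    Nat.choose_zero_right, one_mul, Nat.sub_zero,
    ← numPark_eq_prefCount _ _ _ hl (by omega) (by omega),
    show m + 1 - k + 1 = m + 1 - (k - 1) by omega] at h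
  rw [rhoSeq, rhoSeq, h, Finset.range_eq_Ico, Finset.sum_Ico_add' (fun i =>
    m.choose i * prefCount (m - i) (m + 1 - k) (leadWeight l)) 0 k 1]
  have e : Finset.Ico (0 + 1) (k + 1) = Finset.Icc 1 k := by ext; simp
  rw [e]
  push_cast
  rw [add_div, Finset.sum_div, eq_sub_iff_add_eq']
  refine congrArg (· + _) (Finset.sum_congr rfl fun i hi => ?_)
  symm
  obtain ⟨hi1, hi2⟩ := Finset.mem_Icc.1 hi
  have e1 : m + 1 - i = (m - i) + 1 := by omega
  have e2 : m - i + 1 - (k - i) = m + 1 - k := by omega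
  have him : i ≤ m := by omega
  have hpos : (m : ℝ) - i + 1 + 1 ≠ 0 := by
    have : (i : ℝ) ≤ m := by exact_mod_cast him
    linarith
  rw [e1, rhoSeq, e2, numPark_eq_prefCount _ _ _ hl (by omega) (by omega)]
  push_cast [him]
  rw [show (m : ℝ) + 1 + 1 - i = m - i + 1 + 1 by ring,
    show (m : ℤ) + 1 - i - 2 = m - i + 1 - 2 by ring]
  have hz := zpow_ne_zero ((m : ℤ) - i + 1 - 2) hpos
  generalize ((m : ℝ) - i + 1 + 1) ^ ((m : ℤ) - i + 1 - 2) = z at hz ⊢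
  field_simp

theorem exists_tendsto_rhoSeq (l : ℕ) (hl : 1 ≤ l) (k : ℕ) :
    ∃ x, Tendsto (rhoSeq l k) atTop (𝓝 x) := by
  induction k using Nat.strong_induction_on with
  | _ k ih =>
    rcases Nat.eq_zero_or_pos k with rfl | hk
    · exact exists_tendsto_tauSeq l hl
    · choose! x hx using ih
      refine ⟨_, ((hx (k - 1) (by omega)).sub (tendsto_finsetSum (Finset.Icc 1 k) fun i hi =>
        (tendsto_choose_mul_zpow i i).mul ((hx (k - i)
          (by have := Finset.mem_Icc.1 hi; omega)).comp (tendsto_sub_atTop_nat i)))).congr' ?_⟩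
      filter_upwards [eventually_ge_atTop (k + l)] with n hn
      exact (rhoSeq_rec l k n hl hk hn).symm

theorem tendsto_rhoSeq (l : ℕ) (hl : 1 ≤ l) (k : ℕ) :
    Tendsto (rhoSeq l k) atTop (𝓝 (rho l k)) :=
  tendsto_nhds_limUnder (exists_tendsto_rhoSeq l hl k)

theorem rho_zero (l : ℕ) : rho l 0 = tau l := rfl

theorem rho_rec (l : ℕ) (hl : 1 ≤ l) (k : ℕ) (hk : 1 ≤ k) :
    rho l k = rho l (k - 1) - ∑ i ∈ Finset.Icc 1 k,
      Real.exp (-(i : ℝ)) / (i.factorial : ℝ) * rho l (k - i) := by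
  refine tendsto_nhds_unique (tendsto_rhoSeq l hl k)
    (((tendsto_rhoSeq l hl (k - 1)).sub (tendsto_finsetSum (Finset.Icc 1 k) fun i _ =>
      (tendsto_choose_mul_zpow i i).mul ((tendsto_rhoSeq l hl (k - i)).comp
        (tendsto_sub_atTop_nat i)))).congr' ?_)
  filter_upwards [eventually_ge_atTop (k + l)] with n hn
  exact (rhoSeq_rec l k n hl hk hn).symm

/-! ### Generating functions -/

theorem coeff_expScaled (i : ℕ) :
    PowerSeries.coeff i expScaled = Real.exp (-(i : ℝ)) / i.factorial := by
  rw [expScaled, PowerSeries.coeff_rescale, PowerSeries.coeff_exp, ← Real.exp_nat_mul]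
  simp [div_eq_mul_inv]

open PowerSeries in
theorem constantCoeff_expScaled_sub_X : constantCoeff (expScaled - X) = (1 : ℝ) := by
  rw [map_sub, constantCoeff_X, sub_zero, ← coeff_zero_eq_constantCoeff_apply, coeff_expScaled]
  simp

theorem rhoGen_mul (l : ℕ) (hl : 1 ≤ l) :
    rhoGen l * (expScaled - PowerSeries.X) = PowerSeries.C (rho l 0) := by
  ext k
  rw [mul_sub, map_sub, mul_comm, PowerSeries.coeff_mul,
    Finset.Nat.sum_antidiagonal_eq_sum_range_succ
      (fun i j => PowerSeries.coeff i expScaled * PowerSeries.coeff j (rhoGen l))]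
  cases k with
  | zero => simp [coeff_expScaled, rhoGen, PowerSeries.coeff_zero_eq_constantCoeff]
  | succ k =>
    have h := rho_rec l hl (k + 1) (by omega)
    have e : Finset.Ico (0 + 1) (k + 1 + 1) = Finset.Icc 1 (k + 1) := by ext; simp
    rw [Finset.sum_range_succ', Finset.range_eq_Ico, Finset.sum_Ico_add'
      (fun i => PowerSeries.coeff i expScaled * PowerSeries.coeff (k + 1 - i) (rhoGen l)) 0 (k + 1) 1,
      e, PowerSeries.coeff_succ_mul_X, PowerSeries.coeff_C, if_neg (by omega)]
    simp only [coeff_expScaled, rhoGen, PowerSeries.coeff_mk]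
    rw [Nat.sub_zero, h]
    simp

theorem rhoGen_eq (l : ℕ) (hl : 1 ≤ l) :
    rhoGen l = PowerSeries.C (rho l 0) * (expScaled - PowerSeries.X)⁻¹ := by
  rw [PowerSeries.eq_mul_inv_iff_mul_eq (by simp [constantCoeff_expScaled_sub_X])]
  exact rhoGen_mul l hl

open PowerSeries in
-- With `E = e^(x/e)`, expand `1/(E - x) = ∑ x^m E^(-(m+1))`; here `T m = E^(-m)`. The finite sum
-- telescopes with a remainder divisible by `x^(k+1)`, and `m = k - i` contributes the `i`-th term.
theorem coeff_inv_expScaled_sub_X (k : ℕ) :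
    coeff k (expScaled - X)⁻¹ = ∑ i ∈ Finset.range (k + 1),
      (-1 : ℝ) ^ i * ((k : ℝ) + 1 - i) ^ i / i.factorial * Real.exp (-(i : ℝ)) := by
  set T : ℕ → PowerSeries ℝ := fun m => rescale (-(m : ℝ) * Real.exp (-1)) (exp ℝ) with hT
  have hTE : ∀ m, T (m + 1) * expScaled = T m := fun m => by
    rw [hT, expScaled, exp_mul_exp_eq_exp_add]
    congr 2
    push_cast
    ring
  have htel : ∀ K, (∑ m ∈ Finset.range K, X ^ m * T (m + 1)) * (expScaled - X) =
      1 - X ^ K * T K := by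
    intro K
    induction K with
    | zero => simp [hT, PowerSeries.rescale_zero]
    | succ K ih =>
      rw [Finset.sum_range_succ, add_mul, ih, mul_sub, mul_assoc, hTE]
      ring
  have hinv := PowerSeries.mul_inv_cancel (expScaled - X)
    (by simp [constantCoeff_expScaled_sub_X])
  have h : (expScaled - X)⁻¹ = ∑ m ∈ Finset.range (k + 1), X ^ m * T (m + 1) +
      X ^ (k + 1) * (T (k + 1) * (expScaled - X)⁻¹) := by
    have h1 := congrArg (· * (expScaled - X)⁻¹) (htel (k + 1))
    simp only [mul_assoc, hinv, mul_one] at h1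
    rw [h1]
    ring
  rw [h, map_add, coeff_X_pow_mul', if_neg (by omega), add_zero, map_sum,
    ← Finset.sum_range_reflect]
  refine Finset.sum_congr rfl fun i hi => ?_
  have hi' : i ≤ k := Nat.lt_succ_iff.1 (Finset.mem_range.1 hi)
  rw [coeff_X_pow_mul', if_pos (by omega), show k - (k + 1 - 1 - i) = i by omega, hT,
    coeff_rescale, coeff_exp, show k + 1 - 1 - i + 1 = k + 1 - i by omega,
    Nat.cast_sub (by omega), mul_pow, ← Real.exp_nat_mul, neg_pow]
  push_cast
  simp
  ring

/-- The coefficient of `x^(p+2)` on the left is `τ_{p+1} - τ_{p+2}`; `-2x` comes from `τ_1 = 2`. -/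
theorem tauGen_mul : tauGen * (PowerSeries.X - 1) = numerator := by
  ext n
  rw [mul_sub, mul_one, map_sub, numerator, map_sub, mul_assoc, PowerSeries.coeff_C_mul]
  have h2 : (2 : PowerSeries ℝ) = PowerSeries.C 2 := (map_ofNat PowerSeries.C 2).symm
  rcases n with _ | _ | p
  · simp [tauGen, PowerSeries.coeff_zero_eq_constantCoeff]
  · rw [h2, PowerSeries.coeff_succ_mul_X, PowerSeries.coeff_X_pow_mul', PowerSeries.coeff_C_mul]
    simp [tauGen, tau_one]
  · have h := tau_sub_tau_succ (p + 1) (by omega)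
    have he : Real.exp (-((p + 1 : ℕ) : ℝ)) = Real.exp (-1) * Real.exp (-1) ^ p := by
      rw [← pow_succ', ← Real.exp_nat_mul]; simp
    rw [h2, PowerSeries.coeff_succ_mul_X, show p + 1 + 1 = p + 2 by ring,
      PowerSeries.coeff_X_pow_mul, PowerSeries.coeff_C_mul, PowerSeries.coeff_X,
      if_neg (by omega), PScaled, PowerSeries.coeff_rescale, P, PowerSeries.coeff_mk]
    simp only [tauGen, PowerSeries.coeff_mk, Nat.add_eq_zero_iff, one_ne_zero, and_false,
      OfNat.ofNat_ne_zero, if_false]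
    rw [h, he, Nat.add_sub_cancel]
    push_cast
    rw [show (p : ℤ) + 1 - 2 = p - 1 by ring]
    ring

theorem isUnit_X_sub_one (R : Type*) [CommRing R] : IsUnit (PowerSeries.X - 1 : PowerSeries R) := by
  rw [PowerSeries.isUnit_iff_constantCoeff]
  simp

theorem isUnit_expScaled_sub_X : IsUnit (expScaled - PowerSeries.X) := by
  rw [PowerSeries.isUnit_iff_constantCoeff, constantCoeff_expScaled_sub_X]
  exact isUnit_one

theorem isUnit_denominator₂ : IsUnit denominator₂ :=
  (isUnit_X_sub_one _).mul (isUnit_expScaled_sub_X.map PowerSeries.C)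

theorem rhoGen₂_mul : rhoGen₂ * denominator₂ = PowerSeries.map PowerSeries.C numerator := by
  -- Multiplying by a series in `x` alone acts on each `y`-coefficient, where `rhoGen_mul` leaves
  -- the constant `τ_l`.
  have h : rhoGen₂ * PowerSeries.C (expScaled - PowerSeries.X) =
      PowerSeries.map PowerSeries.C tauGen := by
    ext1 l
    rw [PowerSeries.coeff_mul_C, PowerSeries.coeff_map, rhoGen₂, tauGen, PowerSeries.coeff_mk,
      PowerSeries.coeff_mk]
    split_ifs with hl
    · simp
    · rw [rhoGen_mul l (by omega), rho_zero]
  rw [denominator₂, mul_comm (PowerSeries.X - 1), ← mul_assoc, h, ← tauGen_mul, map_mul]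
  simp

end LeadingParking

theorem mainTheorem11 :
    -- the limits defining `τ_l` exist
    (∀ l : ℕ, 1 ≤ l → Tendsto (LeadingParking.tauSeq l) atTop (𝓝 (LeadingParking.tau l))) ∧
    LeadingParking.tau 1 = 2 ∧
    (∀ l : ℕ, 1 ≤ l →
      LeadingParking.tau l - LeadingParking.tau (l + 1) =
        (l : ℝ) ^ ((l : ℤ) - 2) / ((l - 1).factorial : ℝ) * Real.exp (-(l : ℝ))) ∧
    IsUnit (PowerSeries.X - 1 : PowerSeries ℝ) ∧
    LeadingParking.tauGen =
      LeadingParking.numerator * (PowerSeries.X - 1 : PowerSeries ℝ)⁻¹ ∧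
    -- the limits defining `ρ_{l,k}` exist
    (∀ l : ℕ, 1 ≤ l → ∀ k : ℕ,
      Tendsto (LeadingParking.rhoSeq l k) atTop (𝓝 (LeadingParking.rho l k))) ∧
    (∀ l : ℕ, 1 ≤ l → ∀ k : ℕ, 1 ≤ k →
      LeadingParking.rho l k = LeadingParking.rho l (k - 1) -
        ∑ i ∈ Finset.Icc 1 k,
          Real.exp (-(i : ℝ)) / (i.factorial : ℝ) * LeadingParking.rho l (k - i)) ∧
    (∀ l : ℕ, 1 ≤ l → LeadingParking.rho l 0 = LeadingParking.tau l) ∧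
    (∀ l : ℕ, 1 ≤ l → ∀ k : ℕ,
      LeadingParking.rho l k = LeadingParking.rho l 0 *
        ∑ i ∈ Finset.range (k + 1),
          (-1 : ℝ) ^ i * ((k : ℝ) + 1 - (i : ℝ)) ^ i / (i.factorial : ℝ) *
            Real.exp (-(i : ℝ))) ∧
    IsUnit (LeadingParking.expScaled - PowerSeries.X) ∧
    (∀ l : ℕ, 1 ≤ l →
      LeadingParking.rhoGen l = PowerSeries.C (LeadingParking.rho l 0) *
        (LeadingParking.expScaled - PowerSeries.X)⁻¹) ∧
    IsUnit LeadingParking.denominator₂ ∧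
    LeadingParking.rhoGen₂ =
      PowerSeries.map PowerSeries.C LeadingParking.numerator *
        Ring.inverse LeadingParking.denominator₂ := by
  open LeadingParking in
  exact ⟨tendsto_tauSeq, tau_one, tau_sub_tau_succ, isUnit_X_sub_one ℝ,
    (PowerSeries.eq_mul_inv_iff_mul_eq (by simp)).2 tauGen_mul, tendsto_rhoSeq, rho_rec,
    fun l _ => rho_zero l,
    fun l hl k => by
      rw [← coeff_inv_expScaled_sub_X, ← PowerSeries.coeff_C_mul, ← rhoGen_eq l hl, rhoGen,
        PowerSeries.coeff_mk],
    isUnit_expScaled_sub_X, rhoGen_eq, isUnit_denominator₂,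
    by rw [← rhoGen₂_mul, Ring.mul_inverse_cancel_right _ _ isUnit_denominator₂]⟩
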